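/- Consider a two-hop relaying system (source S, half-duplex relay R, destination D) in slotted time. S always has packets to send, and R has a buffer of $N_r$ packets. In each slot the S-R link and the R-D link are independently ON with probabilities $p_s$ and $p_r$ (i.i.d. over time, $p_s,p_r\in[0,1]$, not both $0$ and not both $1$), and at most $R_s\ge1$, respectively $R_r\ge1$, packets can be sent over them, where $N_r>\max\{R_s,R_r\}$. The state is $\mathbf X=(Q,\mathbf G)$, where $Q\in\mathcal Q=\{0,\dots,N_r\}$ is the relay queue length and $\mathbf G=(G_s,G_r)\in\{0,1\}^2$ is the link connectivity (1 is ON). A stationary policy maps $\mathbf X$ to $(a_s,a_r,u_s,u_r)$ with $a_s,a_r\in\{0,1\}$, $a_s+a_r\le1$, $(a_s,a_r)=(0,0),(0,1),(1,0)$ for $\mathbf G=(0,0),(0,1),(1,0)$ respectively, $u_s\in\{0,\dots,\min\{R_s,N_r-Q\}\}$ and $u_r\in\{0,\dots,\min\{R_r,Q\}\}$. The queue evolves by $Q_{t+1}=Q_t+a_{s,t}u_{s,t}-a_{r,t}u_{r,t}$. A policy is unichain if the induced Markov chain $\{\mathbf X_t\}$ has a single recurrent class. The average throughput is $\liminf_{T\to\infty}\frac1T\sum_{t=1}^T\mathbb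 E[a_{r,t}u_{r,t}]$. A stationary unichain policy is optimal if, for every initial state, it maximizes the average throughput among all stationary unichain policies. Theorem 2 (Threshold Structure of Optimal Policy). There exists $Q_{th}^*\in\mathcal Q$ such that the following policy is unichain and optimal: it transmits at the maximal rates $u_s=\min\{R_s,N_r-Q\}$ and $u_r=\min\{R_r,Q\}$, and for $\mathbf G=(1,1)$ it schedules the R-D link ($(a_s,a_r)=(0,1)$) if $Q>Q_{th}^*$ and the S-R link ($(a_s,a_r)=(1,0)$) otherwise. Moreover, with $\bar p=1-p$, $\bar a_r=1-a_r$ and $[x]^+=\max\{x,0\}$, the Bellman equation $$\theta+V(Q)=\bar p_s\bar p_rV(Q)+p_s\bar p_rV(\min\{Q+R_s,N_r\})+\bar p_sp_r\big(\min\{Q,R_r\}+V([Q-R_r]^+)\big)+p_sp_r\max_{a_r\in\{0,1\}}K_V(Q,a_r),\quad Q\in\mathcal Q,$$ $$K_V(Q,a_r)=a_r\min\{Q,R_r\}+V\big(Q+\bar a_r\min\{N_r-Q,R_s\}-a_r\min\{Q,R_r\}\big),$$ has a solution $(\theta,V)$ with $\theta\in\mathbb R$ and $V:\mathcal Q\to\mathbb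 R$, and for every solution the maximum of $K_V(Q,\cdot)$ over $\{0,1\}$ is attained, for every $Q\in\mathcal Q$, at $$\alpha_r^*(Q)=\begin{cases}1,&Q>Q_{th}^*,\\0,&\text{otherwise.}\end{cases}$$ -/

import Mathlib

namespace TwoHop

/-- Parameters of the two-hop relaying system: maximum rates `Rs`, `Rr` (packets per slot) of the
source-relay and relay-destination links, relay buffer size `N`, and probabilities `ps`, `pr` that
the two links are ON. -/
structure Params where
  Rs : ℕ
  Rr : ℕ
  N : ℕ
  ps : ℝ
  pr : ℝ
  Rs_pos : 0 < Rs
  Rr_pos : 0 < Rr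
  buffer : max Rs Rr < N
  ps_nonneg : 0 ≤ ps
  ps_le_one : ps ≤ 1
  pr_nonneg : 0 ≤ pr
  pr_le_one : pr ≤ 1

/-- A system state `(Q, (G_s, G_r))`: relay queue length and link connectivity (`true` is ON). -/
abbrev State (S : Params) : Type := Fin (S.N + 1) × (Bool × Bool)

/-- A stationary link selection and transmission rate control policy. -/
structure Policy (S : Params) where
  /-- is the S-R link scheduled (1) or not (0) -/
  selS : State S → ℕ
  /-- is the R-D link scheduled (1) or not (0) -/
  selR : State S → ℕ
  /-- transmission rate of the source -/
  rateS : State S → ℕ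
  /-- transmission rate of the relay -/
  rateR : State S → ℕ
  selS_le : ∀ x, selS x ≤ 1
  selR_le : ∀ x, selR x ≤ 1
  orthogonal : ∀ x, selS x + selR x ≤ 1
  off_off : ∀ Q, selS (Q, (false, false)) = 0 ∧ selR (Q, (false, false)) = 0
  off_on : ∀ Q, selS (Q, (false, true)) = 0 ∧ selR (Q, (false, true)) = 1
  on_off : ∀ Q, selS (Q, (true, false)) = 1 ∧ selR (Q, (true, false)) = 0
  rateS_le : ∀ x, rateS x ≤ min S.Rs (S.N - x.1)
  rateR_le : ∀ x, rateR x ≤ min S.Rr x.1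

/-- Queue length after one slot, `Q + a_s u_s - a_r u_r` (there is no truncation, as
`a_r u_r ≤ Q`). -/
def Policy.nextQ {S : Params} (Ω : Policy S) (x : State S) : Fin (S.N + 1) :=
  ⟨x.1 + Ω.selS x * Ω.rateS x - Ω.selR x * Ω.rateR x, by
    have h1 := (Ω.rateS_le x).trans (min_le_right _ _)
    have h2 : Ω.selS x * Ω.rateS x ≤ 1 * Ω.rateS x := Nat.mul_le_mul_right _ (Ω.selS_le x)
    have h3 := x.1.isLt
    omega⟩

/-- Per-slot reward `a_r u_r`: the number of packets delivered to the destination. -/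
def Policy.reward {S : Params} (Ω : Policy S) (x : State S) : ℝ :=
  (Ω.selR x : ℝ) * (Ω.rateR x : ℝ)

/-- Probability of the joint connectivity `g`; the two links are independent. -/
def csiProb (S : Params) (g : Bool × Bool) : ℝ :=
  (if g.1 then S.ps else 1 - S.ps) * (if g.2 then S.pr else 1 - S.pr)

/-- Transition matrix of the Markov chain of system states under a policy; the connectivity of the
next slot is drawn afresh. -/
def Policy.trans {S : Params} (Ω : Policy S) : Matrix (State S) (State S) ℝ :=
  fun x y => if y.1 = Ω.nextQ x then csiProb S y.2 else 0

/-- `y` is accessible from `x` (in zero or more steps). -/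
def Policy.Accessible {S : Params} (Ω : Policy S) (x y : State S) : Prop :=
  ∃ n : ℕ, 0 < (Ω.trans ^ n) x y

/-- A state of the finite chain is recurrent if it is accessible from every state that is
accessible from it. -/
def Policy.Recurrent {S : Params} (Ω : Policy S) (x : State S) : Prop :=
  ∀ y, Ω.Accessible x y → Ω.Accessible y x

/-- The induced chain has a single recurrent class (and possibly transient states). -/
def Policy.Unichain {S : Params} (Ω : Policy S) : Prop :=
  (∃ x, Ω.Recurrent x) ∧
    ∀ x y, Ω.Recurrent x → Ω.Recurrent y → Ω.Accessible x y

/-- Expected reward in slot `t + 1` when the state in slot `1` is `x`. -/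
def Policy.expReward {S : Params} (Ω : Policy S) (x : State S) (t : ℕ) : ℝ :=
  ((Ω.trans ^ t).mulVec Ω.reward) x

/-- Average system throughput
`liminf_{T → ∞} (1/T) ∑_{t=1}^T E[r(X_t, Ω(X_t))]` from the initial state `x`. -/
noncomputable def Policy.throughput {S : Params} (Ω : Policy S) (x : State S) : ℝ :=
  Filter.liminf (fun T : ℕ => (1 / (T : ℝ)) * ∑ t ∈ Finset.range T, Ω.expReward x t) Filter.atTop

/-- `Ω` attains the maximal average throughput among the stationary unichain policies, whatever
the initial state. -/
def Policy.IsOptimal {S : Params} (Ω : Policy S) : Prop :=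
  Ω.Unichain ∧ ∀ Ω' : Policy S, Ω'.Unichain → ∀ x, Ω'.throughput x ≤ Ω.throughput x

/-- Reward plus value of the next queue length when both links are ON, the queue length is `Q`,
the R-D link (`a = 1`) or the S-R link (`a = 0`) is scheduled, and the rates are maximal. -/
def selValue (S : Params) (V : ℕ → ℝ) (Q a : ℕ) : ℝ :=
  (a : ℝ) * ((min Q S.Rr : ℕ) : ℝ) +
    V (Q + (1 - a) * min (S.N - Q) S.Rs - a * min Q S.Rr)

/-- The equivalent Bellman equation for `(θ, V)`. Only the values of `V` on `{0, …, N}` matter;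
`Q - Rr` is the truncated difference `[Q - Rr]⁺`. -/
def Bellman (S : Params) (θ : ℝ) (V : ℕ → ℝ) : Prop :=
  ∀ Q ≤ S.N,
    θ + V Q =
      (1 - S.ps) * (1 - S.pr) * V Q
      + S.ps * (1 - S.pr) * V (min (Q + S.Rs) S.N)
      + (1 - S.ps) * S.pr * (((min Q S.Rr : ℕ) : ℝ) + V (Q - S.Rr))
      + S.ps * S.pr * max (selValue S V Q 0) (selValue S V Q 1)

/-- The threshold action: 1 (schedule R-D) if `Q > th`, and 0 (schedule S-R) otherwise. -/
def thresholdAction (th Q : ℕ) : ℕ := if th < Q then 1 else 0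

/-- The policy with maximal rates that selects links by a threshold when both are ON. -/
def thresholdPolicy (S : Params) (th : ℕ) : Policy S where
  selS x := match x.2 with
    | (false, _) => 0
    | (true, false) => 1
    | (true, true) => 1 - thresholdAction th x.1
  selR x := match x.2 with
    | (_, false) => 0
    | (false, true) => 1
    | (true, true) => thresholdAction th x.1
  rateS x := min S.Rs (S.N - x.1)
  rateR x := min S.Rr x.1
  selS_le := by
    rintro ⟨Q, ⟨_ | _, _ | _⟩⟩ <;> simp
  selR_le := by
    rintro ⟨Q, ⟨_ | _, _ | _⟩⟩ <;> simp [thresholdAction]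
    split <;> simp
  orthogonal := by
    rintro ⟨Q, ⟨_ | _, _ | _⟩⟩ <;> simp [thresholdAction]
    split <;> simp
  off_off := by simp
  off_on := by simp
  on_off := by simp
  rateS_le _ := le_rfl
  rateR_le _ := le_rfl

end TwoHop

/-!
The proof rests on a shape property of the value function that the Bellman operator preserves.
Extend `V : {0, …, N} → ℝ` to `ℤ` with slope `1` below `0` and slope `0` above `N`. The truncations
at the ends of the buffer then disappear: serving the R-D link at maximal rate from queue length `Q`
is worth `Rr + V (Q - Rr)`, and serving the S-R link is worth `V (Q + Rs)`. Call the extension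
regular if its increments `D q = V (q + 1) - V q` satisfy `0 ≤ D q ≤ 1` and
`D (q + Rs + Rr) ≤ D q` (`Regular`).

The last condition says exactly that the advantage of the R-D link over the S-R link is monotone in
`Q`, which gives a threshold (`Regular.exists_threshold`). It also confines the increment at `q` of
the maximum of the two options to the interval from `D (q + Rs)` to `D (q - Rr)`; a shift by
`Rs + Rr` turns the lower end of this interval into the upper end, so the operator preserves
regularity (`Regular.bellmanOp`). Hence the discounted equations have regular solutions, by
contraction, and a compactness argument as the discount factor tends to `1` yields a regular
solution of the Bellman equation itself (`exists_regular_bellman`).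

Every solution has the same threshold because solutions are unique up to a constant
(`Bellman.eq_add_const`): a slot with exactly one link ON leaves no choice, and one of the two
connectivities of this kind has positive probability. Its repetition leads from every queue length
to one end of the buffer, to which both the minimum and the maximum of the difference of two
solutions spread. The same forced moves make a threshold policy unichain
(`thresholdPolicy_unichain`).

Optimality is a telescoping argument: the expected reward in a slot is at most the gain `θ` plus the
decrease of a bounded potential (`Policy.throughput_le`), with equality for the threshold policy
(`Policy.throughput_eq`). Regularity enters here once more, to show that maximal rates are best.
-/

namespace TwoHop

open Matrix

/-! ### The Bellman operator and regular value functions -/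

/-- Right-hand side of the Bellman equation. -/
def bellmanOp (S : Params) (V : ℕ → ℝ) (Q : ℕ) : ℝ :=
  (1 - S.ps) * (1 - S.pr) * V Q
    + S.ps * (1 - S.pr) * V (min (Q + S.Rs) S.N)
    + (1 - S.ps) * S.pr * (((min Q S.Rr : ℕ) : ℝ) + V (Q - S.Rr))
    + S.ps * S.pr * max (selValue S V Q 0) (selValue S V Q 1)

/-- Extension of `V : {0, …, N} → ℝ` to `ℤ`, with slope `1` to the left of `0` and slope `0` to the
right of `N`. It absorbs the truncations at both ends of the buffer. -/
def extend (N : ℕ) (V : ℕ → ℝ) (q : ℤ) : ℝ := V (min q.toNat N) + ((min q 0 : ℤ) : ℝ)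

/-- The unit increments of `E` lie in `[0, 1]`, and do not grow under a shift by `m`. The second
condition is concavity along steps of length `m`; full concavity is not required. -/
structure Regular (m : ℕ) (E : ℤ → ℝ) : Prop where
  nonneg : ∀ q, 0 ≤ E (q + 1) - E q
  le_one : ∀ q, E (q + 1) - E q ≤ 1
  shift : ∀ q, E (q + m + 1) - E (q + m) ≤ E (q + 1) - E q

/-- The Bellman operator on functions on `ℤ`, without truncation. -/
def intBellmanOp (S : Params) (E : ℤ → ℝ) (q : ℤ) : ℝ :=
  (1 - S.ps) * (1 - S.pr) * E q + S.ps * (1 - S.pr) * E (q + S.Rs)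
    + (1 - S.ps) * S.pr * (S.Rr + E (q - S.Rr))
    + S.ps * S.pr * max (E (q + S.Rs)) (S.Rr + E (q - S.Rr))

theorem selValue_zero (S : Params) (V : ℕ → ℝ) {Q : ℕ} (hQ : Q ≤ S.N) :
    selValue S V Q 0 = V (min (Q + S.Rs) S.N) := by
  have h : Q + min (S.N - Q) S.Rs = min (Q + S.Rs) S.N := by omega
  simp [selValue, h]

theorem selValue_one (S : Params) (V : ℕ → ℝ) (Q : ℕ) :
    selValue S V Q 1 = ((min Q S.Rr : ℕ) : ℝ) + V (Q - S.Rr) := by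
  have h : Q - min Q S.Rr = Q - S.Rr := by omega
  simp [selValue, h]

theorem extend_natCast {N : ℕ} (V : ℕ → ℝ) {Q : ℕ} (hQ : Q ≤ N) : extend N V Q = V Q := by
  simp [extend, hQ]

theorem extend_add (S : Params) (V : ℕ → ℝ) (Q : ℕ) :
    extend S.N V (Q + S.Rs) = V (min (Q + S.Rs) S.N) := by
  have h : ((Q : ℤ) + S.Rs).toNat = Q + S.Rs := by omega
  have h' : min ((Q : ℤ) + S.Rs) 0 = 0 := by omega
  simp [extend, h, h']

theorem extend_sub (S : Params) (V : ℕ → ℝ) {Q : ℕ} (hQ : Q ≤ S.N) :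
    (S.Rr : ℝ) + extend S.N V (Q - S.Rr) = ((min Q S.Rr : ℕ) : ℝ) + V (Q - S.Rr) := by
  have h : min ((Q : ℤ) - S.Rr).toNat S.N = Q - S.Rr := by omega
  have h' : (S.Rr : ℤ) + min ((Q : ℤ) - S.Rr) 0 = ((min Q S.Rr : ℕ) : ℤ) := by omega
  have h'' : (S.Rr : ℝ) + ((min ((Q : ℤ) - S.Rr) 0 : ℤ) : ℝ) = ((min Q S.Rr : ℕ) : ℝ) := by
    exact_mod_cast h'
  rw [extend, h, ← h'']
  ring

theorem bellmanOp_eq_intBellmanOp (S : Params) (V : ℕ → ℝ) {Q : ℕ} (hQ : Q ≤ S.N) :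
    bellmanOp S V Q = intBellmanOp S (extend S.N V) Q := by
  rw [bellmanOp, intBellmanOp, selValue_zero S V hQ, selValue_one, extend_natCast V hQ,
    extend_add, extend_sub S V hQ]

/-- With both links ON, the increments of the better of the two options lie between the increments
of the options themselves: the shift condition makes their difference monotone. -/
theorem Regular.max_increment {S : Params} {E : ℤ → ℝ} (hE : Regular (S.Rs + S.Rr) E) (q : ℤ) :
    E (q + S.Rs + 1) - E (q + S.Rs) ≤
        max (E (q + 1 + S.Rs)) (S.Rr + E (q + 1 - S.Rr)) - max (E (q + S.Rs)) (S.Rr + E (q - S.Rr)) ∧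
      max (E (q + 1 + S.Rs)) (S.Rr + E (q + 1 - S.Rr)) - max (E (q + S.Rs)) (S.Rr + E (q - S.Rr)) ≤
        E (q - S.Rr + 1) - E (q - S.Rr) := by
  have h := hE.shift (q - S.Rr)
  have e : q - S.Rr + ((S.Rs + S.Rr : ℕ) : ℤ) = q + S.Rs := by push_cast; ring
  rw [e] at h
  rw [show q + 1 + (S.Rs : ℤ) = q + S.Rs + 1 by ring, show q + 1 - (S.Rr : ℤ) = q - S.Rr + 1 by ring]
  have a1 := le_max_left (E (q + S.Rs + 1)) (S.Rr + E (q - S.Rr + 1))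
  have a2 := le_max_right (E (q + S.Rs + 1)) (S.Rr + E (q - S.Rr + 1))
  have b1 := le_max_left (E (q + S.Rs)) (S.Rr + E (q - S.Rr))
  have b2 := le_max_right (E (q + S.Rs)) (S.Rr + E (q - S.Rr))
  constructor
  · rcases max_choice (E (q + S.Rs)) (S.Rr + E (q - S.Rr)) with h' | h' <;> linarith
  · rcases max_choice (E (q + S.Rs + 1)) (S.Rr + E (q - S.Rr + 1)) with h' | h' <;> linarith

/-- Averages over the four connectivities are monotone. -/
theorem mix_le_mix (S : Params) {a b c d a' b' c' d' : ℝ} (ha : a ≤ a') (hb : b ≤ b')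
    (hc : c ≤ c') (hd : d ≤ d') :
    (1 - S.ps) * (1 - S.pr) * a + S.ps * (1 - S.pr) * b + (1 - S.ps) * S.pr * c
        + S.ps * S.pr * d ≤
      (1 - S.ps) * (1 - S.pr) * a' + S.ps * (1 - S.pr) * b' + (1 - S.ps) * S.pr * c'
        + S.ps * S.pr * d' := by
  have h1 := S.ps_nonneg
  have h2 := S.pr_nonneg
  have h3 := sub_nonneg.2 S.ps_le_one
  have h4 := sub_nonneg.2 S.pr_le_one
  gcongr

theorem mix_const (S : Params) (c : ℝ) :
    (1 - S.ps) * (1 - S.pr) * c + S.ps * (1 - S.pr) * c + (1 - S.ps) * S.pr * c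
        + S.ps * S.pr * c = c := by
  ring

theorem Regular.intBellmanOp {S : Params} {E : ℤ → ℝ} (hE : Regular (S.Rs + S.Rr) E) :
    Regular (S.Rs + S.Rr) (intBellmanOp S E) := by
  set M : ℤ → ℝ := fun q => max (E (q + S.Rs)) (S.Rr + E (q - S.Rr)) with hM
  have key : ∀ q, TwoHop.intBellmanOp S E (q + 1) - TwoHop.intBellmanOp S E q =
      (1 - S.ps) * (1 - S.pr) * (E (q + 1) - E q)
        + S.ps * (1 - S.pr) * (E (q + S.Rs + 1) - E (q + S.Rs))
        + (1 - S.ps) * S.pr * (E (q - S.Rr + 1) - E (q - S.Rr))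
        + S.ps * S.pr * (M (q + 1) - M q) := by
    intro q
    simp only [TwoHop.intBellmanOp, hM]
    rw [show q + 1 + (S.Rs : ℤ) = q + S.Rs + 1 by ring,
      show q + 1 - (S.Rr : ℤ) = q - S.Rr + 1 by ring]
    ring
  refine ⟨fun q => ?_, fun q => ?_, fun q => ?_⟩
  · rw [key, ← mix_const S 0]
    exact mix_le_mix S (hE.nonneg _) (hE.nonneg _) (hE.nonneg _)
      ((hE.nonneg _).trans (hE.max_increment q).1)
  · rw [key]
    refine (mix_le_mix S (hE.le_one _) (hE.le_one _) (hE.le_one _)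
      ((hE.max_increment q).2.trans (hE.le_one _))).trans_eq (mix_const S 1)
  · rw [key, key]
    refine mix_le_mix S (hE.shift q) ?_ ?_ ?_
    · rw [add_right_comm q]
      exact hE.shift (q + S.Rs)
    · rw [← sub_add_eq_add_sub q]
      exact hE.shift (q - S.Rr)
    -- A shift by `Rs + Rr` carries the lower increment at `q` to the upper one at `q + Rs + Rr`.
    · refine (hE.max_increment _).2.trans (le_of_eq_of_le ?_ (hE.max_increment q).1)
      rw [show q + ((S.Rs + S.Rr : ℕ) : ℤ) - S.Rr = q + S.Rs by push_cast; ring]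

/-- An extended function is regular as soon as it agrees on `[0, N]` with a regular one. -/
theorem Regular.extend_of_eqOn {N m : ℕ} {V : ℕ → ℝ} {E : ℤ → ℝ} (hE : Regular m E)
    (h : ∀ Q ≤ N, V Q = E (Q : ℕ)) : Regular m (extend N V) := by
  have left : ∀ q : ℤ, q < 0 → extend N V (q + 1) - extend N V q = 1 := by
    intro q hq
    have h1 : (q + 1).toNat = 0 := by omega
    have h2 : q.toNat = 0 := by omega
    have h3 : min (q + 1) 0 = q + 1 := by omega
    have h4 : min q 0 = q := by omega
    simp only [extend, h1, h2, h3, h4]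
    push_cast
    ring
  have right : ∀ q : ℤ, (N : ℤ) ≤ q → extend N V (q + 1) - extend N V q = 0 := by
    intro q hq
    have h1 : min (q + 1).toNat N = N := by omega
    have h2 : min q.toNat N = N := by omega
    have h3 : min (q + 1) 0 = 0 := by omega
    have h4 : min q 0 = 0 := by omega
    simp only [extend, h1, h2, h3, h4, sub_self]
  have mid : ∀ q : ℤ, 0 ≤ q → q < N → extend N V (q + 1) - extend N V q = E (q + 1) - E q := by
    intro q h0 hq
    lift q to ℕ using h0
    have h1 := extend_natCast V (show q + 1 ≤ N by omega)
    push_cast at h1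
    rw [h1, extend_natCast V (by omega), h _ (by omega), h _ (by omega)]
    push_cast
    rfl
  have nonneg : ∀ q, 0 ≤ extend N V (q + 1) - extend N V q := by
    intro q
    rcases lt_or_ge q 0 with h0 | h0
    · simp [left q h0]
    rcases lt_or_ge q N with hN | hN
    · rw [mid q h0 hN]
      exact hE.nonneg q
    · exact (right q hN).ge
  have le_one : ∀ q, extend N V (q + 1) - extend N V q ≤ 1 := by
    intro q
    rcases lt_or_ge q 0 with h0 | h0
    · exact (left q h0).le
    rcases lt_or_ge q N with hN | hN
    · rw [mid q h0 hN]
      exact hE.le_one q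
    · simp [right q hN]
  refine ⟨nonneg, le_one, fun q => ?_⟩
  rcases lt_or_ge q 0 with h0 | h0
  · rw [left q h0]
    exact le_one _
  rcases lt_or_ge (q + m) N with hN | hN
  · rw [mid q h0 (by omega), mid (q + m) (by omega) hN]
    exact hE.shift q
  · rw [right _ hN]
    exact nonneg _

theorem Regular.bellmanOp {S : Params} {V : ℕ → ℝ}
    (hV : Regular (S.Rs + S.Rr) (extend S.N V)) :
    Regular (S.Rs + S.Rr) (extend S.N (bellmanOp S V)) :=
  hV.intBellmanOp.extend_of_eqOn fun _ hQ => bellmanOp_eq_intBellmanOp S V hQ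

/-- Regularity survives discounting, though the slope of the extension to the left of `0` does not
scale. -/
theorem Regular.extend_mul {N m : ℕ} {V : ℕ → ℝ} (hV : Regular m (extend N V)) {β : ℝ}
    (h0 : 0 ≤ β) (h1 : β ≤ 1) : Regular m (extend N fun n => β * V n) := by
  have hE : Regular m fun q => β * extend N V q := by
    refine ⟨fun q => ?_, fun q => ?_, fun q => ?_⟩ <;> simp only [← mul_sub]
    · exact mul_nonneg h0 (hV.nonneg q)
    · exact mul_le_one₀ h1 (hV.nonneg q) (hV.le_one q)
    · exact mul_le_mul_of_nonneg_left (hV.shift q) h0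
  exact hE.extend_of_eqOn fun Q hQ => by simp only [extend_natCast V hQ]

theorem Regular.extend_add_const {N m : ℕ} {V : ℕ → ℝ} (hV : Regular m (extend N V)) (c : ℝ) :
    Regular m (extend N fun n => V n + c) := by
  have hE : Regular m fun q => extend N V q + c := by
    refine ⟨fun q => ?_, fun q => ?_, fun q => ?_⟩ <;> simp only [add_sub_add_right_eq_sub]
    exacts [hV.nonneg q, hV.le_one q, hV.shift q]
  exact hE.extend_of_eqOn fun Q hQ => by simp only [extend_natCast V hQ]

theorem Regular.mono_extend {N m : ℕ} {V : ℕ → ℝ} (hV : Regular m (extend N V)) {a b : ℕ}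
    (hab : a ≤ b) (hb : b ≤ N) : V a ≤ V b := by
  have h : Monotone (extend N V) := monotone_int_of_le_succ fun q => sub_nonneg.1 (hV.nonneg q)
  have := h (Int.ofNat_le.2 hab)
  rwa [extend_natCast V hb, extend_natCast V (hab.trans hb)] at this

theorem Regular.le_add_extend {N m : ℕ} {V : ℕ → ℝ} (hV : Regular m (extend N V)) {a b : ℕ}
    (hab : a ≤ b) (hb : b ≤ N) : V b ≤ V a + ((b : ℝ) - a) := by
  have h : Monotone fun q : ℤ => (q : ℝ) - extend N V q := monotone_int_of_le_succ fun q => by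
    have := hV.le_one q
    push_cast
    linarith
  have := h (Int.ofNat_le.2 hab)
  simp only [extend_natCast V hb, extend_natCast V (hab.trans hb), Int.cast_natCast] at this
  linarith

/-- The advantage of the R-D link over the S-R link grows with the queue length. -/
theorem Regular.selValue_sub_mono {S : Params} {V : ℕ → ℝ}
    (hV : Regular (S.Rs + S.Rr) (extend S.N V)) {a b : ℕ} (hab : a ≤ b) (hb : b ≤ S.N) :
    selValue S V a 1 - selValue S V a 0 ≤ selValue S V b 1 - selValue S V b 0 := by
  set E := extend S.N V
  have h : Monotone fun q : ℤ => (S.Rr : ℝ) + E (q - S.Rr) - E (q + S.Rs) :=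
    monotone_int_of_le_succ fun q => by
      have h := hV.shift (q - S.Rr)
      have e : q - S.Rr + ((S.Rs + S.Rr : ℕ) : ℤ) = q + S.Rs := by push_cast; ring
      rw [e] at h
      rw [show q + 1 + (S.Rs : ℤ) = q + S.Rs + 1 by ring,
        show q + 1 - (S.Rr : ℤ) = q - S.Rr + 1 by ring]
      linarith
  have := h (Int.ofNat_le.2 hab)
  have ha := hab.trans hb
  simp only [E] at this
  rwa [extend_sub S V ha, extend_sub S V hb, extend_add, extend_add, ← selValue_zero S V ha,
    ← selValue_zero S V hb, ← selValue_one, ← selValue_one] at this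

theorem Regular.exists_threshold {S : Params} {V : ℕ → ℝ}
    (hV : Regular (S.Rs + S.Rr) (extend S.N V)) :
    ∃ Qth ≤ S.N, ∀ Q ≤ S.N, ∀ a ≤ 1,
      selValue S V Q a ≤ selValue S V Q (thresholdAction Qth Q) := by
  classical
  let P : ℕ → Prop := fun Q => selValue S V Q 1 - selValue S V Q 0 ≤ 0
  have h0 : P 0 := by
    have h := hV.mono_extend (Nat.zero_le (min (0 + S.Rs) S.N)) (min_le_right _ _)
    simp only [P]
    rw [selValue_zero S V (Nat.zero_le _), selValue_one]
    simpa using h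
  refine ⟨Nat.findGreatest P S.N, Nat.findGreatest_le _, fun Q hQ a ha => ?_⟩
  by_cases h : Nat.findGreatest P S.N < Q
  · have hP : ¬ P Q := Nat.findGreatest_is_greatest h hQ
    simp only [P, not_le] at hP
    rw [thresholdAction, if_pos h]
    interval_cases a <;> linarith
  · have hP : P (Nat.findGreatest P S.N) := Nat.findGreatest_spec (Nat.zero_le _) h0
    have := hV.selValue_sub_mono (not_lt.1 h) (Nat.findGreatest_le _)
    simp only [P] at hP
    rw [thresholdAction, if_neg h]
    interval_cases a <;> linarith

/-! ### Existence of a regular solution of the Bellman equation -/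

theorem bellmanOp_sub_le (S : Params) {V W : ℕ → ℝ} {c : ℝ} (h : ∀ n ≤ S.N, V n - W n ≤ c)
    {Q : ℕ} (hQ : Q ≤ S.N) : bellmanOp S V Q - bellmanOp S W Q ≤ c := by
  have hu := h (min (Q + S.Rs) S.N) (min_le_right _ _)
  have hd := h (Q - S.Rr) (by omega)
  have hm : max (selValue S V Q 0) (selValue S V Q 1) - max (selValue S W Q 0) (selValue S W Q 1)
      ≤ c := by
    rw [selValue_zero S V hQ, selValue_one, selValue_zero S W hQ, selValue_one]
    rw [sub_le_iff_le_add]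
    refine max_le ?_ ?_
    · linarith [le_max_left (W (min (Q + S.Rs) S.N)) (((min Q S.Rr : ℕ) : ℝ) + W (Q - S.Rr))]
    · linarith [le_max_right (W (min (Q + S.Rs) S.N)) (((min Q S.Rr : ℕ) : ℝ) + W (Q - S.Rr))]
  have := (mix_le_mix S (h Q hQ) hu hd hm).trans_eq (mix_const S c)
  rw [bellmanOp, bellmanOp]
  linarith

theorem bellmanOp_add_const (S : Params) (V : ℕ → ℝ) (c : ℝ) (Q : ℕ) :
    bellmanOp S (fun n => V n + c) Q = bellmanOp S V Q + c := by
  have h : ∀ a, selValue S (fun n => V n + c) Q a = selValue S V Q a + c := fun a => by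
    rw [selValue, selValue]
    ring
  rw [bellmanOp, bellmanOp, h, h, max_add_add_right]
  ring

/-- A function on `{0, …, N}` as a function on `ℕ`, constant beyond `N`. -/
def toNatFun {N : ℕ} (v : Fin (N + 1) → ℝ) (n : ℕ) : ℝ := v ⟨min n N, by omega⟩

theorem toNatFun_of_le {N : ℕ} (v : Fin (N + 1) → ℝ) {n : ℕ} (hn : n ≤ N) :
    toNatFun v n = v ⟨n, by omega⟩ := by
  simp [toNatFun, hn]

theorem extend_toNatFun {N : ℕ} (V : ℕ → ℝ) :
    extend N (toNatFun fun i : Fin (N + 1) => V i) = extend N V := by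
  ext q
  simp [extend, toNatFun]

theorem continuous_toNatFun {N : ℕ} (n : ℕ) :
    Continuous fun v : Fin (N + 1) → ℝ => toNatFun v n :=
  continuous_apply _

theorem continuous_bellmanOp (S : Params) (Q : ℕ) :
    Continuous fun v : Fin (S.N + 1) → ℝ => bellmanOp S (toNatFun v) Q := by
  have h := fun n => continuous_toNatFun (N := S.N) n
  unfold bellmanOp selValue
  fun_prop

theorem isClosed_regular (N m : ℕ) :
    IsClosed {v : Fin (N + 1) → ℝ | Regular m (extend N (toNatFun v))} := by
  have h : ∀ q, Continuous fun v : Fin (N + 1) → ℝ => extend N (toNatFun v) q := fun q =>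
    (continuous_toNatFun _).add continuous_const
  have e : {v : Fin (N + 1) → ℝ | Regular m (extend N (toNatFun v))} =
      ⋂ q : ℤ, {v | 0 ≤ extend N (toNatFun v) (q + 1) - extend N (toNatFun v) q} ∩
        {v | extend N (toNatFun v) (q + 1) - extend N (toNatFun v) q ≤ 1} ∩
        {v | extend N (toNatFun v) (q + m + 1) - extend N (toNatFun v) (q + m) ≤
          extend N (toNatFun v) (q + 1) - extend N (toNatFun v) q} := by
    ext v
    simp only [Set.mem_ofPred_eq, Set.mem_iInter, Set.mem_inter_iff]
    exact ⟨fun hv q => ⟨⟨hv.nonneg q, hv.le_one q⟩, hv.shift q⟩,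
      fun hv => ⟨fun q => (hv q).1.1, fun q => (hv q).1.2, fun q => (hv q).2⟩⟩
  rw [e]
  refine isClosed_iInter fun q => IsClosed.inter (IsClosed.inter ?_ ?_) ?_
  · exact isClosed_le continuous_const ((h _).sub (h _))
  · exact isClosed_le ((h _).sub (h _)) continuous_const
  · exact isClosed_le ((h _).sub (h _)) ((h _).sub (h _))

theorem regular_zero (N m : ℕ) :
    Regular m (extend N (toNatFun (0 : Fin (N + 1) → ℝ))) := by
  have hE : Regular m fun _ => (0 : ℝ) := ⟨by simp, by simp, by simp⟩
  exact hE.extend_of_eqOn fun _ _ => rfl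

/-- For each discount factor `β < 1` the discounted Bellman equation has a regular solution: the
operator is a `β`-contraction that preserves the closed set of regular functions. -/
theorem exists_discounted (S : Params) {β : ℝ} (h0 : 0 ≤ β) (h1 : β < 1) :
    ∃ V : ℕ → ℝ, Regular (S.Rs + S.Rr) (extend S.N V) ∧
      ∀ Q ≤ S.N, bellmanOp S (fun n => β * V n) Q = V Q := by
  let F : (Fin (S.N + 1) → ℝ) → Fin (S.N + 1) → ℝ :=
    fun v i => bellmanOp S (fun n => β * toNatFun v n) i
  let K := {v : Fin (S.N + 1) → ℝ | Regular (S.Rs + S.Rr) (extend S.N (toNatFun v))}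
  have hsub : ∀ v w i, F v i - F w i ≤ β * dist v w := fun v w i =>
    bellmanOp_sub_le S (fun n hn => by
      rw [← mul_sub]
      refine mul_le_mul_of_nonneg_left ((le_abs_self _).trans ?_) h0
      exact dist_le_pi_dist v w _) (Nat.le_of_lt_succ i.2)
  have hF : ContractingWith ⟨β, h0⟩ F := by
    refine ⟨by exact_mod_cast h1, LipschitzWith.of_dist_le_mul fun v w => ?_⟩
    refine (dist_pi_le_iff (mul_nonneg h0 dist_nonneg)).2 fun i => ?_
    rw [Real.dist_eq, abs_sub_le_iff]
    refine ⟨hsub v w i, ?_⟩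
    rw [dist_comm]
    exact hsub w v i
  have hK : Set.MapsTo F K K := fun v (hv : Regular _ _) => by
    have := (hv.extend_mul h0 h1.le).bellmanOp
    change Regular _ (extend S.N (toNatFun (F v)))
    rwa [extend_toNatFun]
  obtain ⟨v, hvK, hv, -⟩ := (hF.restrict hK).exists_fixedPoint' (isClosed_regular _ _).isComplete
    hK (regular_zero _ _) (edist_ne_top _ _)
  refine ⟨toNatFun v, hvK, fun Q hQ => ?_⟩
  rw [toNatFun_of_le v hQ]
  exact congrFun hv ⟨Q, by omega⟩

/-- Vanishing discount: the defect of the Bellman equation, as a continuous function on the compact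
set of regular functions with `V 0 = 0`, has infimum `0`, which is therefore attained. -/
theorem exists_regular_bellman (S : Params) :
    ∃ (θ : ℝ) (V : ℕ → ℝ), Bellman S θ V ∧ Regular (S.Rs + S.Rr) (extend S.N V) := by
  let K := {v : Fin (S.N + 1) → ℝ | Regular (S.Rs + S.Rr) (extend S.N (toNatFun v))} ∩
    {v | v 0 = 0}
  have hKc : IsCompact K := by
    refine IsCompact.of_isClosed_subset (isCompact_Icc (a := 0) (b := fun _ => (S.N : ℝ)))
      ((isClosed_regular _ _).inter (isClosed_eq (continuous_apply _) continuous_const)) ?_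
    rintro v ⟨hv, hv0 : v 0 = 0⟩
    have hv : Regular _ _ := hv
    have h0 : toNatFun v 0 = 0 := (toNatFun_of_le v (Nat.zero_le _)).trans hv0
    refine ⟨fun i => ?_, fun i => ?_⟩
    all_goals
      have hi := Nat.le_of_lt_succ i.2
      have hi' : (i : ℝ) ≤ S.N := by exact_mod_cast hi
      have a := hv.mono_extend (Nat.zero_le i) hi
      have b := hv.le_add_extend (Nat.zero_le i) hi
      rw [h0, toNatFun_of_le v hi] at a b
      simp at a b ⊢
      linarith
  let φ : (Fin (S.N + 1) → ℝ) → ℝ := fun v =>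
    ‖fun i : Fin (S.N + 1) => bellmanOp S (toNatFun v) i - v i - bellmanOp S (toNatFun v) 0‖
  have hφ : Continuous φ := by
    have h := continuous_bellmanOp S
    fun_prop
  obtain ⟨v, hvK, hv⟩ := hKc.exists_isMinOn ⟨0, regular_zero _ _, rfl⟩ hφ.continuousOn
  have hle : ∀ β : ℝ, 0 ≤ β → β < 1 → φ v ≤ (1 - β) * S.N := by
    intro β h0 h1
    obtain ⟨V, hV, hVβ⟩ := exists_discounted S h0 h1
    let W : ℕ → ℝ := fun n => β * V n + -(β * V 0)
    have hW : Regular (S.Rs + S.Rr) (extend S.N W) :=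
      (hV.extend_mul h0 h1.le).extend_add_const _
    let w : Fin (S.N + 1) → ℝ := fun i => W i
    have hwK : w ∈ K := ⟨by simpa only [Set.mem_ofPred_eq, w, extend_toNatFun], by simp [w, W]⟩
    have hop : ∀ Q ≤ S.N, bellmanOp S (toNatFun w) Q = V Q - β * V 0 := fun Q hQ => by
      have e : bellmanOp S (toNatFun w) Q = bellmanOp S W Q := by
        rw [bellmanOp_eq_intBellmanOp S _ hQ, bellmanOp_eq_intBellmanOp S _ hQ, extend_toNatFun]
      rw [e, bellmanOp_add_const, hVβ Q hQ]
      ring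
    refine (hv hwK).trans ?_
    have hβ := sub_nonneg.2 h1.le
    refine (pi_norm_le_iff_of_nonneg (by positivity)).2 fun i => ?_
    have hi := Nat.le_of_lt_succ i.2
    have a := hV.mono_extend (Nat.zero_le i) hi
    have b := hV.le_add_extend (Nat.zero_le i) hi
    have hi' : (i : ℝ) ≤ S.N := by exact_mod_cast hi
    have e : bellmanOp S (toNatFun w) i - w i - bellmanOp S (toNatFun w) 0 =
        (1 - β) * (V i - V 0) := by
      rw [hop _ hi, hop 0 (Nat.zero_le _)]
      simp only [w, W]
      ring
    rw [e, Real.norm_eq_abs, abs_mul, abs_of_nonneg hβ, abs_of_nonneg (sub_nonneg.2 a)]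
    refine mul_le_mul_of_nonneg_left ?_ hβ
    simp at b
    linarith
  have hφ0 : φ v ≤ 0 := by
    refine le_of_forall_pos_le_add fun ε hε => ?_
    have hN : (0 : ℝ) < S.N + 1 := by positivity
    -- A discount factor with `(1 - β) N ≤ ε`.
    refine (hle (max 0 (1 - ε / (S.N + 1))) (le_max_left _ _) ?_).trans ?_
    · exact max_lt one_pos (by linarith [div_pos hε hN])
    · have h1 : 1 - max 0 (1 - ε / (S.N + 1)) ≤ ε / (S.N + 1) := by
        linarith [le_max_right 0 (1 - ε / (S.N + 1))]
      calc (1 - max 0 (1 - ε / (S.N + 1))) * (S.N : ℝ)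
          ≤ ε / (S.N + 1) * S.N := mul_le_mul_of_nonneg_right h1 (Nat.cast_nonneg _)
        _ ≤ ε / (S.N + 1) * (S.N + 1) := by
            refine mul_le_mul_of_nonneg_left (by linarith) (div_pos hε hN).le
        _ = 0 + ε := by rw [div_mul_cancel₀ _ hN.ne', zero_add]
  refine ⟨bellmanOp S (toNatFun v) 0, toNatFun v, fun Q hQ => ?_, hvK.1⟩
  have := congrFun (norm_le_zero_iff.1 hφ0) ⟨Q, by omega⟩
  change _ = bellmanOp S (toNatFun v) Q
  rw [toNatFun_of_le v hQ]
  simp only [Pi.zero_apply] at this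
  linarith

/-! ### Uniqueness of the value function up to a constant -/

/-- Queue length after a slot with exactly one link ON and maximal rates. -/
def forcedNext (S : Params) (g : Bool × Bool) (Q : ℕ) : ℕ :=
  if g.1 then min (Q + S.Rs) S.N else Q - S.Rr

/-- Unless the links are both always ON or both always OFF, one of the two connectivities with a
single link ON has positive probability; repeating it drives every queue to one end of the
buffer. -/
theorem exists_hub (S : Params) (h_zero : ¬ (S.ps = 0 ∧ S.pr = 0))
    (h_one : ¬ (S.ps = 1 ∧ S.pr = 1)) :
    ∃ g : Bool × Bool, (g = (true, false) ∨ g = (false, true)) ∧ 0 < csiProb S g ∧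
      ∃ h ≤ S.N, ∀ p : ℕ → Prop, (∀ Q ≤ S.N, p Q → p (forcedNext S g Q)) →
        ∀ Q ≤ S.N, p Q → p h := by
  have a1 := S.ps_nonneg
  have a2 := sub_nonneg.2 S.ps_le_one
  have b1 := S.pr_nonneg
  have b2 := sub_nonneg.2 S.pr_le_one
  by_cases hup : 0 < S.ps * (1 - S.pr)
  · refine ⟨(true, false), .inl rfl, by simpa [csiProb] using hup, S.N, le_rfl, ?_⟩
    intro p hp Q hQ
    induction hk : S.N - Q using Nat.strong_induction_on generalizing Q with
    | _ k ih =>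
      intro hpQ
      rcases hQ.eq_or_lt with rfl | hlt
      · exact hpQ
      have hs := S.Rs_pos
      have := hp Q hQ hpQ
      simp only [forcedNext, if_true] at this
      exact ih _ (by omega) _ (min_le_right _ _) rfl this
  · have hdown : 0 < (1 - S.ps) * S.pr := by
      have h0 : S.ps * (1 - S.pr) = 0 := le_antisymm (not_lt.1 hup) (mul_nonneg a1 b2)
      refine lt_of_le_of_ne (mul_nonneg a2 b1) fun h1 => ?_
      rcases mul_eq_zero.1 h0 with h | h <;> rcases mul_eq_zero.1 h1.symm with h' | h'
      · linarith
      · exact h_zero ⟨h, h'⟩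
      · exact h_one ⟨by linarith, by linarith⟩
      · linarith
    refine ⟨(false, true), .inr rfl, by simpa [csiProb] using hdown, 0, Nat.zero_le _, ?_⟩
    intro p hp Q hQ
    induction Q using Nat.strong_induction_on with
    | _ Q ih =>
      intro hpQ
      rcases Nat.eq_zero_or_pos Q with rfl | hpos
      · exact hpQ
      have hr := S.Rr_pos
      have := hp Q hQ hpQ
      simp only [forcedNext, Bool.false_eq_true, if_false] at this
      exact ih _ (by omega) (by omega) this

theorem forcedNext_le (S : Params) (g : Bool × Bool) {Q : ℕ} (hQ : Q ≤ S.N) :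
    forcedNext S g Q ≤ S.N := by
  unfold forcedNext
  split <;> omega

/-- The difference of two solutions is superharmonic, up to the difference of the gains, along the
forced moves. -/
theorem csiProb_mul_le_of_bellman {S : Params} {θ θ' c : ℝ} {V V' : ℕ → ℝ} (hV : Bellman S θ V)
    (hV' : Bellman S θ' V') (hc : ∀ n ≤ S.N, c ≤ V' n - V n) {g : Bool × Bool}
    (hg : g = (true, false) ∨ g = (false, true)) {Q : ℕ} (hQ : Q ≤ S.N) :
    csiProb S g * (V' (forcedNext S g Q) - V (forcedNext S g Q) - c) ≤
      θ' - θ + (V' Q - V Q - c) := by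
  have a1 := S.ps_nonneg
  have a2 := sub_nonneg.2 S.ps_le_one
  have b1 := S.pr_nonneg
  have b2 := sub_nonneg.2 S.pr_le_one
  have h := hV Q hQ
  have h' := hV' Q hQ
  have hu := hc (min (Q + S.Rs) S.N) (min_le_right _ _)
  have hd := hc (Q - S.Rr) (by omega)
  have hm : c ≤ max (selValue S V' Q 0) (selValue S V' Q 1)
      - max (selValue S V Q 0) (selValue S V Q 1) := by
    rw [selValue_zero S V hQ, selValue_one, selValue_zero S V' hQ, selValue_one,
      le_sub_iff_add_le', ← le_sub_iff_add_le]
    refine max_le ?_ ?_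
    · linarith [le_max_left (V' (min (Q + S.Rs) S.N)) (((min Q S.Rr : ℕ) : ℝ) + V' (Q - S.Rr))]
    · linarith [le_max_right (V' (min (Q + S.Rs) S.N)) (((min Q S.Rr : ℕ) : ℝ) + V' (Q - S.Rr))]
  have n1 := mul_nonneg (mul_nonneg a2 b2) (sub_nonneg.2 (hc Q hQ))
  have n2 := mul_nonneg (mul_nonneg a1 b2) (sub_nonneg.2 hu)
  have n3 := mul_nonneg (mul_nonneg a2 b1) (sub_nonneg.2 hd)
  have n4 := mul_nonneg (mul_nonneg a1 b1) (sub_nonneg.2 hm)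
  rcases hg with rfl | rfl <;> simp only [csiProb, forcedNext, if_true, Bool.false_eq_true, if_false]
  · linear_combination n1 + n3 + n4 + h - h'
  · linear_combination n1 + n2 + n4 + h - h'

theorem gain_le_of_bellman {S : Params} {θ θ' : ℝ} {V V' : ℕ → ℝ} (hV : Bellman S θ V)
    (hV' : Bellman S θ' V') : θ ≤ θ' := by
  obtain ⟨q, hq, hmin⟩ := (Finset.range (S.N + 1)).exists_min_image (fun n => V' n - V n) ⟨0, by simp⟩
  rw [Finset.mem_range_succ_iff] at hq
  have hc : ∀ n ≤ S.N, V' q - V q ≤ V' n - V n := fun n hn =>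
    hmin n (Finset.mem_range_succ_iff.2 hn)
  have h := csiProb_mul_le_of_bellman hV hV' hc (.inl rfl) hq
  have h1 := mul_nonneg (mul_nonneg S.ps_nonneg (sub_nonneg.2 S.pr_le_one))
    (sub_nonneg.2 (hc _ (forcedNext_le S (true, false) hq)))
  simp only [csiProb, if_true, Bool.false_eq_true, if_false] at h
  linarith

/-- The minimum of the difference of two solutions spreads along the forced moves to the hub; by
symmetry so does the maximum, and the difference is constant. -/
theorem Bellman.eq_add_const {S : Params} (h_zero : ¬ (S.ps = 0 ∧ S.pr = 0))
    (h_one : ¬ (S.ps = 1 ∧ S.pr = 1)) {θ θ' : ℝ} {V V' : ℕ → ℝ} (hV : Bellman S θ V)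
    (hV' : Bellman S θ' V') : ∃ c, ∀ Q ≤ S.N, V' Q = V Q + c := by
  obtain rfl : θ = θ' := le_antisymm (gain_le_of_bellman hV hV') (gain_le_of_bellman hV' hV)
  obtain ⟨g, hg, hpos, h, hh, hub⟩ := exists_hub S h_zero h_one
  have key : ∀ {V V' : ℕ → ℝ}, Bellman S θ V → Bellman S θ V' →
      ∀ Q ≤ S.N, V' h - V h ≤ V' Q - V Q := by
    intro V V' hV hV'
    obtain ⟨q, hq, hmin⟩ := (Finset.range (S.N + 1)).exists_min_image (fun n => V' n - V n)
      ⟨0, by simp⟩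
    rw [Finset.mem_range_succ_iff] at hq
    have hc : ∀ n ≤ S.N, V' q - V q ≤ V' n - V n := fun n hn =>
      hmin n (Finset.mem_range_succ_iff.2 hn)
    have := hub (fun n => V' n - V n ≤ V' q - V q) (fun Q hQ hle => by
      have h2 := csiProb_mul_le_of_bellman hV hV' hc hg hQ
      have h3 : csiProb S g * (V' (forcedNext S g Q) - V (forcedNext S g Q) - (V' q - V q)) ≤ 0 := by
        linarith
      have := nonpos_of_mul_nonpos_right h3 hpos
      linarith) q hq le_rfl
    exact fun Q hQ => this.trans (hc Q hQ)
  refine ⟨V' h - V h, fun Q hQ => ?_⟩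
  linarith [key hV hV' Q hQ, key hV' hV Q hQ]

/-! ### The Markov chain of a policy -/

theorem csiProb_nonneg (S : Params) (g : Bool × Bool) : 0 ≤ csiProb S g := by
  have a1 := S.ps_nonneg
  have a2 := sub_nonneg.2 S.ps_le_one
  have b1 := S.pr_nonneg
  have b2 := sub_nonneg.2 S.pr_le_one
  unfold csiProb
  split <;> split <;> positivity

theorem sum_csiProb_mul (S : Params) (f : Bool × Bool → ℝ) :
    ∑ g, csiProb S g * f g =
      (1 - S.ps) * (1 - S.pr) * f (false, false) + S.ps * (1 - S.pr) * f (true, false)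
        + (1 - S.ps) * S.pr * f (false, true) + S.ps * S.pr * f (true, true) := by
  rw [Fintype.sum_prod_type]
  simp [csiProb]
  ring

namespace Policy

variable {S : Params} (Ω : Policy S)

theorem trans_mulVec (f : State S → ℝ) (x : State S) :
    (Ω.trans *ᵥ f) x = ∑ g, csiProb S g * f (Ω.nextQ x, g) := by
  simp [Matrix.mulVec, dotProduct, trans, Fintype.sum_prod_type_right, ite_mul]

theorem trans_nonneg (x y : State S) : 0 ≤ Ω.trans x y := by
  unfold trans
  split
  exacts [csiProb_nonneg S _, le_rfl]

theorem pow_trans_nonneg (n : ℕ) (x y : State S) : 0 ≤ (Ω.trans ^ n) x y := by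
  induction n generalizing x y with
  | zero =>
    rw [pow_zero, Matrix.one_apply]
    split <;> simp
  | succ n ih =>
    rw [pow_succ, Matrix.mul_apply]
    exact Finset.sum_nonneg fun z _ => mul_nonneg (ih x z) (Ω.trans_nonneg z y)

theorem pow_trans_mulVec_mono (n : ℕ) {f f' : State S → ℝ} (h : ∀ x, f x ≤ f' x) (x : State S) :
    ((Ω.trans ^ n) *ᵥ f) x ≤ ((Ω.trans ^ n) *ᵥ f') x :=
  Finset.sum_le_sum fun y _ => mul_le_mul_of_nonneg_left (h y) (Ω.pow_trans_nonneg n x y)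

theorem pow_trans_mulVec_const (n : ℕ) (c : ℝ) :
    (Ω.trans ^ n) *ᵥ (fun _ => c) = fun _ => c := by
  induction n with
  | zero => simp
  | succ n ih =>
    have h : Ω.trans *ᵥ (fun _ => c) = fun _ => c := by
      ext x
      rw [trans_mulVec, sum_csiProb_mul, mix_const]
    rw [pow_succ, ← Matrix.mulVec_mulVec, h, ih]

theorem Accessible.trans' {Ω : Policy S} {x y z : State S} (hxy : Ω.Accessible x y)
    (hyz : Ω.Accessible y z) : Ω.Accessible x z := by
  obtain ⟨m, hm⟩ := hxy
  obtain ⟨n, hn⟩ := hyz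
  refine ⟨m + n, ?_⟩
  rw [pow_add, Matrix.mul_apply]
  exact (mul_pos hm hn).trans_le (Finset.single_le_sum
    (f := fun y => (Ω.trans ^ m) x y * (Ω.trans ^ n) y z)
    (fun w _ => mul_nonneg (Ω.pow_trans_nonneg m x w) (Ω.pow_trans_nonneg n w z))
    (Finset.mem_univ y))

theorem accessible_nextQ (x : State S) {g : Bool × Bool} (hg : 0 < csiProb S g) :
    Ω.Accessible x (Ω.nextQ x, g) :=
  ⟨1, by simpa [trans] using hg⟩

theorem unichain_of_accessible {Ω : Policy S} {z : State S} (hz : ∀ x, Ω.Accessible x z) :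
    Ω.Unichain :=
  ⟨⟨z, fun y _ => hz y⟩, fun x y _ hy => (hz x).trans' (hy z (hz y))⟩

end Policy

theorem thresholdPolicy_unichain (S : Params) (h_zero : ¬ (S.ps = 0 ∧ S.pr = 0))
    (h_one : ¬ (S.ps = 1 ∧ S.pr = 1)) (th : ℕ) : (thresholdPolicy S th).Unichain := by
  obtain ⟨g, hg, hpos, h, hh, hub⟩ := exists_hub S h_zero h_one
  refine Policy.unichain_of_accessible (z := (⟨h, Nat.lt_succ_of_le hh⟩, g)) fun x => ?_
  set Ω := thresholdPolicy S th
  have hstart := Ω.accessible_nextQ x hpos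
  have hnext : ∀ Q : Fin (S.N + 1), ((Ω.nextQ (Q, g) : Fin _) : ℕ) = forcedNext S g Q := by
    intro Q
    have := Nat.le_of_lt_succ Q.2
    rcases hg with rfl | rfl <;>
      simp [Ω, Policy.nextQ, thresholdPolicy, forcedNext] <;> omega
  obtain ⟨Q, hQ, hacc⟩ := hub (fun n => ∃ Q : Fin (S.N + 1), (Q : ℕ) = n ∧ Ω.Accessible x (Q, g))
    (by
      rintro _ - ⟨Q, rfl, hacc⟩
      exact ⟨_, hnext Q, hacc.trans' (Ω.accessible_nextQ _ hpos)⟩)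
    _ (Nat.le_of_lt_succ (Ω.nextQ x).2) ⟨_, rfl, hstart⟩
  convert hacc
  exact hQ.symm

/-! ### Verification of optimality -/

/-- Best value of reward plus `V` of the next queue length in a state, over the admissible link
selections, at maximal rates. -/
def stateValue (S : Params) (V : ℕ → ℝ) (x : State S) : ℝ :=
  match x.2 with
  | (false, false) => V x.1
  | (true, false) => V (min (x.1 + S.Rs) S.N)
  | (false, true) => ((min (x.1 : ℕ) S.Rr : ℕ) : ℝ) + V (x.1 - S.Rr)
  | (true, true) => max (selValue S V x.1 0) (selValue S V x.1 1)

theorem sum_stateValue {S : Params} {θ : ℝ} {V : ℕ → ℝ} (hV : Bellman S θ V)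
    (Q : Fin (S.N + 1)) : ∑ g, csiProb S g * stateValue S V (Q, g) = θ + V Q := by
  rw [sum_csiProb_mul, hV Q (Nat.le_of_lt_succ Q.2)]
  rfl

theorem Policy.reward_nonneg {S : Params} (Ω : Policy S) (x : State S) : 0 ≤ Ω.reward x :=
  mul_nonneg (Nat.cast_nonneg _) (Nat.cast_nonneg _)

/-- By regularity of `V`, no admissible selection and rates beat the maximal rates. -/
theorem Policy.reward_add_le {S : Params} (Ω : Policy S) {V : ℕ → ℝ}
    (hV : Regular (S.Rs + S.Rr) (extend S.N V)) (x : State S) :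
    Ω.reward x + V (Ω.nextQ x) ≤ stateValue S V x := by
  obtain ⟨Q, g⟩ := x
  have hQ := Nat.le_of_lt_succ Q.2
  have hu := Ω.rateS_le (Q, g)
  have hr := Ω.rateR_le (Q, g)
  simp only [le_min_iff] at hu hr
  have idle : V Q ≤ V (min (Q + S.Rs) S.N) := hV.mono_extend (by omega) (by omega)
  have up : V (Q + Ω.rateS (Q, g)) ≤ V (min (Q + S.Rs) S.N) := hV.mono_extend (by omega) (by omega)
  have down : (Ω.rateR (Q, g) : ℝ) + V (Q - Ω.rateR (Q, g)) ≤
      ((min (Q : ℕ) S.Rr : ℕ) : ℝ) + V (Q - S.Rr) := by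
    have h := hV.le_add_extend (a := Q - S.Rr) (b := Q - Ω.rateR (Q, g)) (by omega) (by omega)
    have e : Q - Ω.rateR (Q, g) + Ω.rateR (Q, g) = Q - S.Rr + min (Q : ℕ) S.Rr := by omega
    have e' : ((Q - Ω.rateR (Q, g) : ℕ) : ℝ) + Ω.rateR (Q, g) =
        ((Q - S.Rr : ℕ) : ℝ) + ((min (Q : ℕ) S.Rr : ℕ) : ℝ) := by exact_mod_cast e
    linarith
  rcases g with ⟨_ | _, _ | _⟩
  · simp [reward, nextQ, stateValue, (Ω.off_off Q).1, (Ω.off_off Q).2]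
  · simpa [reward, nextQ, stateValue, (Ω.off_on Q).1, (Ω.off_on Q).2] using down
  · simpa [reward, nextQ, stateValue, (Ω.on_off Q).1, (Ω.on_off Q).2] using up
  · have horth := Ω.orthogonal (Q, (true, true))
    simp only [stateValue]
    rw [selValue_zero S V hQ, selValue_one]
    obtain ⟨h1, h2⟩ | ⟨h1, h2⟩ | ⟨h1, h2⟩ :
        (Ω.selS (Q, (true, true)) = 0 ∧ Ω.selR (Q, (true, true)) = 0) ∨
        (Ω.selS (Q, (true, true)) = 0 ∧ Ω.selR (Q, (true, true)) = 1) ∨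
        (Ω.selS (Q, (true, true)) = 1 ∧ Ω.selR (Q, (true, true)) = 0) := by omega
    · refine le_max_of_le_left ?_
      simpa [reward, nextQ, h1, h2] using idle
    · refine le_max_of_le_right ?_
      simpa [reward, nextQ, h1, h2] using down
    · refine le_max_of_le_left ?_
      simpa [reward, nextQ, h1, h2] using up

theorem thresholdPolicy_reward_add {S : Params} {V : ℕ → ℝ} {th : ℕ}
    (hth : ∀ Q ≤ S.N, ∀ a ≤ 1, selValue S V Q a ≤ selValue S V Q (thresholdAction th Q))
    (x : State S) :
    (thresholdPolicy S th).reward x + V ((thresholdPolicy S th).nextQ x) = stateValue S V x := by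
  obtain ⟨Q, g⟩ := x
  have hQ := Nat.le_of_lt_succ Q.2
  have up : (Q : ℕ) + min S.Rs (S.N - Q) = min (Q + S.Rs) S.N := by omega
  have down : (Q : ℕ) - min (Q : ℕ) S.Rr = Q - S.Rr := by omega
  rcases g with ⟨_ | _, _ | _⟩
  · simp [Policy.reward, Policy.nextQ, stateValue, thresholdPolicy]
  · simp [Policy.reward, Policy.nextQ, stateValue, thresholdPolicy, down, min_comm S.Rr]
  · simp [Policy.reward, Policy.nextQ, stateValue, thresholdPolicy, up]
  · have h0 := hth Q hQ 0 zero_le_one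
    have h1 := hth Q hQ 1 le_rfl
    have hmax : max (selValue S V Q 0) (selValue S V Q 1) =
        selValue S V Q (thresholdAction th Q) := by
      refine le_antisymm (max_le h0 h1) ?_
      unfold thresholdAction
      split
      exacts [le_max_right _ _, le_max_left _ _]
    simp only [stateValue, hmax]
    simp only [Policy.reward, Policy.nextQ, thresholdPolicy, selValue]
    rw [min_comm S.Rs, min_comm S.Rr]

namespace Policy

variable {S : Params} (Ω : Policy S)

/-- One step of the telescoping argument. -/
theorem pow_trans_mulVec_next {θ : ℝ} {V : ℕ → ℝ} (hV : Bellman S θ V) (t : ℕ) (x : State S) :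
    ((Ω.trans ^ (t + 1)) *ᵥ stateValue S V) x =
      θ + ((Ω.trans ^ t) *ᵥ fun y => V (Ω.nextQ y)) x := by
  have h : Ω.trans *ᵥ stateValue S V = (fun _ => θ) + fun y => V (Ω.nextQ y) := by
    ext y
    rw [trans_mulVec, sum_stateValue hV]
    rfl
  rw [pow_succ, ← Matrix.mulVec_mulVec, h, Matrix.mulVec_add, pow_trans_mulVec_const]
  rfl

theorem exists_abs_pow_trans_mulVec_le (f : State S → ℝ) (x : State S) :
    ∃ C, ∀ t, |((Ω.trans ^ t) *ᵥ f) x| ≤ C := by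
  refine ⟨‖f‖, fun t => abs_le.2 ⟨?_, ?_⟩⟩
  · have := Ω.pow_trans_mulVec_mono t (f := fun _ => -‖f‖) (f' := f)
      (fun y => (abs_le.1 (norm_le_pi_norm f y)).1) x
    rwa [pow_trans_mulVec_const] at this
  · have := Ω.pow_trans_mulVec_mono t (f := f) (f' := fun _ => ‖f‖)
      (fun y => (abs_le.1 (norm_le_pi_norm f y)).2) x
    rwa [pow_trans_mulVec_const] at this

theorem tendsto_telescoped (θ : ℝ) (f : State S → ℝ) (x : State S) :
    Filter.Tendsto (fun T : ℕ => (1 / (T : ℝ)) *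
      (T * θ + (f x - ((Ω.trans ^ T) *ᵥ f) x))) Filter.atTop (nhds θ) := by
  obtain ⟨C, hC⟩ := Ω.exists_abs_pow_trans_mulVec_le f x
  have h0 : Filter.Tendsto (fun T : ℕ => (1 / (T : ℝ)) * (f x - ((Ω.trans ^ T) *ᵥ f) x))
      Filter.atTop (nhds 0) := by
    refine squeeze_zero_norm (a := fun T : ℕ => (1 / (T : ℝ)) * (|f x| + C)) (fun T => ?_) ?_
    · rw [norm_mul, Real.norm_of_nonneg (by positivity : (0 : ℝ) ≤ 1 / T)]
      refine mul_le_mul_of_nonneg_left ?_ (by positivity)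
      exact (abs_sub _ _).trans (by linarith [hC T])
    · simpa using tendsto_one_div_atTop_nhds_zero_nat.mul_const (|f x| + C)
  have h1 := h0.const_add θ
  rw [add_zero] at h1
  refine h1.congr' ?_
  filter_upwards [Filter.eventually_gt_atTop 0] with T hT
  have : (T : ℝ) ≠ 0 := by positivity
  field_simp

theorem throughput_le {θ : ℝ} {V : ℕ → ℝ} (hV : Bellman S θ V)
    (h : ∀ y, Ω.reward y + V (Ω.nextQ y) ≤ stateValue S V y) (x : State S) :
    Ω.throughput x ≤ θ := by
  have hsum : ∀ T : ℕ, ∑ t ∈ Finset.range T, Ω.expReward x t ≤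
      T * θ + (stateValue S V x - ((Ω.trans ^ T) *ᵥ stateValue S V) x) := by
    intro T
    induction T with
    | zero => simp
    | succ T ih =>
      have h1 := Ω.pow_trans_mulVec_mono T (f := Ω.reward + fun y => V (Ω.nextQ y)) h x
      rw [Matrix.mulVec_add, Pi.add_apply] at h1
      rw [Finset.sum_range_succ, Ω.pow_trans_mulVec_next hV]
      simp only [expReward] at ih ⊢
      push_cast
      linarith
  have hlim := Ω.tendsto_telescoped θ (stateValue S V) x
  rw [← hlim.liminf_eq]
  refine Filter.liminf_le_liminf (.of_forall fun T => ?_) ?_ hlim.isBoundedUnder_le.isCoboundedUnder_ge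
  · exact mul_le_mul_of_nonneg_left (hsum T) (by positivity)
  · refine Filter.isBoundedUnder_of ⟨0, fun T => ?_⟩
    refine mul_nonneg (by positivity) (Finset.sum_nonneg fun t _ => ?_)
    have := Ω.pow_trans_mulVec_mono t (f := fun _ => 0) (f' := Ω.reward) Ω.reward_nonneg x
    rwa [pow_trans_mulVec_const] at this

theorem throughput_eq {θ : ℝ} {V : ℕ → ℝ} (hV : Bellman S θ V)
    (h : ∀ y, Ω.reward y + V (Ω.nextQ y) = stateValue S V y) (x : State S) :
    Ω.throughput x = θ := by
  have hsum : ∀ T : ℕ, ∑ t ∈ Finset.range T, Ω.expReward x t =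
      T * θ + (stateValue S V x - ((Ω.trans ^ T) *ᵥ stateValue S V) x) := by
    intro T
    induction T with
    | zero => simp
    | succ T ih =>
      have h1 : Ω.reward + (fun y => V (Ω.nextQ y)) = stateValue S V := funext h
      have h2 := congrFun (congrArg (fun f => (Ω.trans ^ T) *ᵥ f) h1) x
      simp only [Matrix.mulVec_add, Pi.add_apply] at h2
      rw [Finset.sum_range_succ, Ω.pow_trans_mulVec_next hV]
      simp only [expReward] at ih ⊢
      push_cast
      linarith
  rw [throughput]
  simp_rw [hsum]
  exact (Ω.tendsto_telescoped θ (stateValue S V) x).liminf_eq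

end Policy

end TwoHop

theorem theorem2 (S : TwoHop.Params)
    (h_zero : ¬ (S.ps = 0 ∧ S.pr = 0)) (h_one : ¬ (S.ps = 1 ∧ S.pr = 1)) :
    ∃ Qth : ℕ, Qth ≤ S.N ∧
      (TwoHop.thresholdPolicy S Qth).IsOptimal ∧
      (∃ (θ : ℝ) (V : ℕ → ℝ), TwoHop.Bellman S θ V) ∧
      ∀ (θ : ℝ) (V : ℕ → ℝ), TwoHop.Bellman S θ V →
        ∀ Q ≤ S.N, ∀ a : ℕ, a ≤ 1 →
          TwoHop.selValue S V Q a ≤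
            TwoHop.selValue S V Q (TwoHop.thresholdAction Qth Q) := by
  obtain ⟨θ, V, hV, hreg⟩ := TwoHop.exists_regular_bellman S
  obtain ⟨Qth, hQth, hth⟩ := hreg.exists_threshold
  refine ⟨Qth, hQth, ⟨TwoHop.thresholdPolicy_unichain S h_zero h_one Qth, ?_⟩, ⟨θ, V, hV⟩, ?_⟩
  · intro Ω _ x
    rw [TwoHop.Policy.throughput_eq _ hV (TwoHop.thresholdPolicy_reward_add hth)]
    exact Ω.throughput_le hV (Ω.reward_add_le hreg) x
  · intro θ' V' hV' Q hQ a ha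
    obtain ⟨c, hc⟩ := hV.eq_add_const h_zero h_one hV'
    have hsel : ∀ b, b ≤ 1 → TwoHop.selValue S V' Q b = TwoHop.selValue S V Q b + c := by
      intro b hb
      rw [TwoHop.selValue, TwoHop.selValue, hc _ ?_]
      · ring
      · interval_cases b <;> omega
    rw [hsel a ha, hsel _ (by unfold TwoHop.thresholdAction; split <;> simp)]
    linarith [hth Q hQ a ha]
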